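/- **Theorem (Law of large numbers).** Let $\{Z_j\}_{j\in\mathbb Z}$ be a (strictly) stationary sequence of real random variables such that 1. $E|Z_0|^k<\infty$ for all $k\ge 1$; 2. $E Z_0=0$; 3. $\sum_{j_1\in\mathbb Z}\cdots\sum_{j_r\in\mathbb Z}|\mathbf C(Z_0,Z_{j_1},\dots,Z_{j_r})|<\infty$ for all $r\ge 1$, where $\mathbf C(X_1,\dots,X_k)=i^{-k}\frac{\partial^k}{\partial t_1\cdots\partial t_k}\log E\exp\bigl(\sum_{j}it_jX_j\bigr)\big|_{t_1=\cdots=t_k=0}$ denotes the joint cumulant. For each positive integer $p$ let $n=n(p)$ be a positive integer and $b=b(p)$ a positive real number with $b\le p$, such that $b\to\infty$, $n\to\infty$ and $b/n\to0$ as $p\to\infty$. Let $\{Z^{(i)}_j\}_{j\in\mathbb Z}$, $i=1,2,\dots$, be i.i.d. copies of the sequence $\{Z_j\}_{j\in\mathbb Z}$. Let $X$ be the $n\times p$ matrix with entries $X_{ij}=Z^{(i)}_j/\sqrt n$, let $Y=Y^{(p)}$ be the symmetric $p\times p$ matrix with $Y_{ij}=(X^TX)_{ij}$ if $|i-j|\le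 b$ and $Y_{ij}=0$ otherwise, let $\lambda_1,\dots,\lambda_p$ be the eigenvalues of $Y$ counted with multiplicity, and let $L^{(p)}=p^{-1}\sum_{i=1}^p\delta_{\lambda_i}$. Put $R(j)=\operatorname{Cov}(Z_0,Z_j)$ and $f_Z(\theta)=\sum_{j\in\mathbb Z}e^{2\pi ij\theta}R(j)$, and let $\nu_Z=m\circ f_Z^{-1}$ be the law of $f_Z$ under Lebesgue measure $m$ on $[0,1]$. Then the series defining $f_Z$ converges absolutely and $f_Z$ is real valued; all moments of $\nu_Z$ are finite, with $$\int_{\mathbb R}x^k\,\nu_Z(dx)=R^{\star k}(0)\qquad(k\ge 0),$$ where $R^{\star 0}(j)=\delta_{j0}$, $R^{\star(k+1)}=R\star R^{\star k}$ and $(F\star G)(j)=\sum_{l\in\mathbb Z}F(j-l)G(l)$; and $L^{(p)}$ converges weakly to $\nu_Z$, in probability, as $p\to\infty$: for every bounded continuous $f:\mathbb R\to\mathbb R$, $\int f\,dL^{(p)}\to\int f\,d\nu_Z$ in probability. -/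

import Mathlib

open MeasureTheory ProbabilityTheory Filter Topology
open scoped ENNReal BoundedContinuousFunction

noncomputable section

namespace BandedCovariance

/-- The joint cumulant `C(X₁, …, X_k)` of real random variables with moments of all orders:
`i⁻ᵏ ∂ᵏ/∂t₁⋯∂t_k log E exp(i ∑ t_j X_j)` at `t = 0`, i.e. the mixed partial derivative, in the
`k` coordinate directions, of the logarithm of the characteristic function of the law of
`(X₁, …, X_k)`. The value is kept as a complex number. -/
def jointCumulant {Ω : Type*} [MeasurableSpace Ω] (μ : Measure Ω) {k : ℕ}
    (X : Fin k → Ω → ℝ) : ℂ :=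
  (Complex.I ^ k)⁻¹ *
    iteratedFDeriv ℝ k
      (fun t : EuclideanSpace ℝ (Fin k) =>
        Complex.log (charFun (μ.map fun ω => (WithLp.toLp 2 fun j => X j ω : EuclideanSpace ℝ (Fin k))) t))
      0 (fun j => EuclideanSpace.single j (1 : ℝ))

/-- A two-sided sequence of real random variables is (strictly) stationary: the law of the whole
sequence is invariant under all shifts of the index. -/
structure IsStationary {Ω : Type*} [MeasurableSpace Ω] (μ : Measure Ω)
    (Z : ℤ → Ω → ℝ) : Prop where
  measurable : ∀ j, Measurable (Z j)
  shift : ∀ m : ℤ, IdentDistrib (fun ω (j : ℤ) => Z (j + m) ω) (fun ω (j : ℤ) => Z j ω) μ μ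

/-- Moments of all orders, mean zero, and joint cumulant summability. -/
structure HasSummableCumulants {Ω : Type*} [MeasurableSpace Ω] (μ : Measure Ω)
    (Z : ℤ → Ω → ℝ) : Prop where
  moments : ∀ k : ℕ, 1 ≤ k → Integrable (fun ω => |Z 0 ω| ^ k) μ
  mean_zero : ∫ ω, Z 0 ω ∂μ = 0
  summable : ∀ r : ℕ, 1 ≤ r → Summable fun j : Fin r → ℤ =>
    ‖jointCumulant μ fun i : Fin (r + 1) => Z ((Fin.cons 0 j : Fin (r + 1) → ℤ) i)‖

/-- `W 0, W 1, …` is an i.i.d. family of copies of the sequence `Z` (as random elements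
of `ℝ^ℤ`). -/
structure IsIIDCopies {Ω₀ Ω : Type*} [MeasurableSpace Ω₀] [MeasurableSpace Ω]
    (μ : Measure Ω₀) (Z : ℤ → Ω₀ → ℝ) (P : Measure Ω) (W : ℕ → ℤ → Ω → ℝ) : Prop where
  measurable : ∀ i j, Measurable (W i j)
  identDistrib : ∀ i, IdentDistrib (fun ω (j : ℤ) => W i j ω) (fun ω (j : ℤ) => Z j ω) P μ
  indep : iIndepFun (fun i ω (j : ℤ) => W i j ω) P

/-- The `n × p` data matrix with entries `Z_j^{(i)} / √n`. Its rows are the first `n` copies and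
its columns the indices `1, …, p`. -/
def dataMatrix {Ω : Type*} (W : ℕ → ℤ → Ω → ℝ) (n p : ℕ) (ω : Ω) :
    Matrix (Fin n) (Fin p) ℝ :=
  Matrix.of fun i j => W (i : ℕ) ((j : ℤ) + 1) ω / √(n : ℝ)

/-- The banding matrix: `B i j = 1` if `|i - j| ≤ b`, and `0` otherwise. -/
def bandMatrix (b : ℝ) (p : ℕ) : Matrix (Fin p) (Fin p) ℝ :=
  Matrix.of fun i j => if |(i : ℝ) - (j : ℝ)| ≤ b then 1 else 0

/-- The banded empirical covariance matrix `Y i j = B i j * (Xᵀ X) i j`. -/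
def bandedCov {Ω : Type*} (W : ℕ → ℤ → Ω → ℝ) (n p : ℕ) (b : ℝ) (ω : Ω) :
    Matrix (Fin p) (Fin p) ℝ :=
  Matrix.of fun i j =>
    bandMatrix b p i j * ((dataMatrix W n p ω).transpose * dataMatrix W n p ω) i j

theorem bandedCov_isHermitian {Ω : Type*} (W : ℕ → ℤ → Ω → ℝ) (n p : ℕ) (b : ℝ) (ω : Ω) :
    (bandedCov W n p b ω).IsHermitian := by
  ext i j
  simp only [bandedCov, bandMatrix, Matrix.conjTranspose_apply, Matrix.of_apply,
    Matrix.mul_apply, Matrix.transpose_apply, star_trivial]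
  rw [abs_sub_comm]
  congr 1
  exact Finset.sum_congr rfl fun x _ => mul_comm _ _

/-- The empirical measure `p⁻¹ ∑ δ_{λ_i}` of the eigenvalues, with multiplicity, of the banded
empirical covariance matrix. -/
def empiricalMeasure {Ω : Type*} (W : ℕ → ℤ → Ω → ℝ) (n p : ℕ) (b : ℝ) (ω : Ω) : Measure ℝ :=
  (p : ℝ≥0∞)⁻¹ • ∑ i : Fin p, Measure.dirac ((bandedCov_isHermitian W n p b ω).eigenvalues i)

/-- The covariance sequence `R(j) = Cov(Z₀, Z_j)`. -/
def covSeq {Ω : Type*} [MeasurableSpace Ω] (μ : Measure Ω) (Z : ℤ → Ω → ℝ) (j : ℤ) : ℝ :=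
  covariance (Z 0) (Z j) μ

/-- The spectral density `f(θ) = ∑_{j ∈ ℤ} e^{2πijθ} R(j)`. The real part only serves to make the
value a real number. -/
def spectralDensity (R : ℤ → ℝ) (θ : ℝ) : ℝ :=
  (∑' j : ℤ, Complex.exp (2 * Real.pi * Complex.I * j * θ) * (R j : ℂ)).re

/-- The law of the spectral density, as a random variable on `[0, 1]` with Lebesgue measure. -/
def spectralLaw (R : ℤ → ℝ) : Measure ℝ :=
  (volume.restrict (Set.Icc (0 : ℝ) 1)).map (spectralDensity R)

/-- Convolution powers on `ℤ`: `R^{⋆0} = δ₀` and `R^{⋆(m+1)} = R ⋆ R^{⋆m}`, where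
`(F ⋆ G)(j) = ∑_k F(j - k) G(k)`. -/
def convPow (R : ℤ → ℝ) : ℕ → ℤ → ℝ
  | 0 => fun j => if j = 0 then 1 else 0
  | m + 1 => fun j => ∑' k : ℤ, R (j - k) * convPow R m k

/-- Weak convergence in probability of random measures `L p` on `ℝ` to a deterministic measure
`ν`: for every bounded continuous `f`, `∫ f dL_p → ∫ f dν` in probability. -/
def TendstoWeaklyInProbability {Ω : Type*} [MeasurableSpace Ω] (P : Measure Ω)
    (L : ℕ → Ω → Measure ℝ) (ν : Measure ℝ) : Prop :=
  ∀ f : ℝ →ᵇ ℝ,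
    TendstoInMeasure P (fun p ω => ∫ x, f x ∂(L p ω)) atTop (fun _ => ∫ x, f x ∂ν)

end BandedCovariance

end

/-!
The banded empirical covariance matrix `Y` is close, in the Hilbert–Schmidt norm per row, to the
Laurent operator with entries `R (i - l)`, whose spectral measure is the law of `f_Z`. This closeness
is a second moment computation, and it already forces the eigenvalue distributions together.

*Deterministic comparison.* Let `Y` be a symmetric `p × p` matrix with eigenvalues `λ_j` and real
orthonormal eigenvectors `u_j`, and let `e_θ = (e^{2πikθ})_{k < p}`. The weights
`w_j(θ) = |⟨u_j, e_θ⟩|²` integrate to `1` over `θ ∈ [0, 1]` for each `j`, and sum to `p` over `j` for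
each `θ`. Thus `p⁻¹ w_j(θ) dθ` couples the empirical eigenvalue measure with the law of `f_Z(θ)`.
Under this coupling the mean squared distance of `λ_j` and `f_Z(θ)` is
`p⁻¹ ∫ ‖(Y - f_Z(θ)) e_θ‖² dθ`, which by Parseval's identity is
`p⁻¹ ∑_{i < p} ∑_{l ∈ ℤ} |Y i l - R (i - l)|²`, with `Y` extended by zero (`laurentDefect`). Since
`f_Z` is bounded, a bounded continuous `f` satisfies `|f x - f y| ≤ ε + C (x - y)²` for `y` in the
range of `f_Z`, hence `|∫ f dL - ∫ f dν| ≤ ε + C p⁻¹ laurentDefect Y R`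
(`abs_sum_eigenvalues_sub_le`, `exists_abs_sub_le_add_mul_sq`).

*Expectation.* Inside the band each entry of `Y` is an average of `n` independent variables with mean
`R (i - l)` and variance at most `E Z₀⁴`, so the band contributes at most `(2b + 1) E Z₀⁴ / n → 0` per
row (`integral_empiricalCov_sub_sq_le`). Outside the band or outside the matrix only `R (i - l)²`
remains; its average over the rows tends to zero by dominated convergence, because `b → ∞` and only
`|m|` rows have their offset-`m` entry outside the matrix (`tendsto_tail`). Markov's inequality gives
convergence in probability.

*Cumulants and moments.* The cumulant of two variables is their covariance (`jointCumulant_two`), so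
the cumulant condition with `r = 1` is the summability of `R`. The `k`-th power of `f_Z` is the
Fourier series of `R^{⋆k}` (`trigSeries_convPow`), whose zeroth coefficient is the `k`-th moment.
-/

noncomputable section

namespace BandedCovariance

/-! ### Absolutely convergent Fourier series on the integers -/

/-- The character `θ ↦ e^{2πijθ}` of frequency `j`. -/
def expChar (j : ℤ) (θ : ℝ) : ℂ := Complex.exp (2 * Real.pi * Complex.I * j * θ)

/-- The Fourier series `θ ↦ ∑_j e^{2πijθ} c j`. -/
def trigSeries (c : ℤ → ℂ) (θ : ℝ) : ℂ := ∑' j : ℤ, expChar j θ * c j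

theorem norm_expChar (j : ℤ) (θ : ℝ) : ‖expChar j θ‖ = 1 := by
  have : (2 * Real.pi * Complex.I * j * θ : ℂ) = ((2 * Real.pi * j * θ : ℝ) : ℂ) * Complex.I := by
    push_cast; ring
  rw [expChar, this, Complex.norm_exp_ofReal_mul_I]

theorem continuous_expChar (j : ℤ) : Continuous (expChar j) := by
  unfold expChar; fun_prop

theorem expChar_zero (θ : ℝ) : expChar 0 θ = 1 := by simp [expChar]

theorem expChar_add (j k : ℤ) (θ : ℝ) : expChar (j + k) θ = expChar j θ * expChar k θ := by
  rw [expChar, expChar, expChar, ← Complex.exp_add]; push_cast; ring_nf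

theorem conj_expChar (j : ℤ) (θ : ℝ) : (starRingEnd ℂ) (expChar j θ) = expChar (-j) θ := by
  rw [expChar, expChar, ← Complex.exp_conj]
  simp [show (starRingEnd ℂ) 2 = 2 from Complex.conj_ofNat 2]

theorem integral_expChar (j : ℤ) : ∫ θ in (0 : ℝ)..1, expChar j θ = if j = 0 then 1 else 0 := by
  split_ifs with h
  · simp [h, expChar_zero]
  · have hc : (2 * Real.pi * Complex.I * j : ℂ) ≠ 0 := by
      simp [h, Real.pi_ne_zero]
    unfold expChar
    rw [integral_exp_mul_complex hc]
    have : (2 * Real.pi * Complex.I * j * (1 : ℝ) : ℂ) = j * (2 * Real.pi * Complex.I) := by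
      push_cast; ring
    rw [this, Complex.exp_int_mul_two_pi_mul_I]
    simp

theorem summable_norm_expChar_mul {c : ℤ → ℂ} (hc : Summable fun j => ‖c j‖) (θ : ℝ) :
    Summable fun j => ‖expChar j θ * c j‖ := by
  simpa [norm_expChar] using hc

theorem hasSum_trigSeries {c : ℤ → ℂ} (hc : Summable fun j => ‖c j‖) (θ : ℝ) :
    HasSum (fun j => expChar j θ * c j) (trigSeries c θ) :=
  (summable_norm_expChar_mul hc θ).of_norm.hasSum

theorem norm_trigSeries_le {c : ℤ → ℂ} (hc : Summable fun j => ‖c j‖) (θ : ℝ) :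
    ‖trigSeries c θ‖ ≤ ∑' j, ‖c j‖ := by
  have := norm_tsum_le_tsum_norm (summable_norm_expChar_mul hc θ)
  simpa [norm_expChar, trigSeries] using this

theorem continuous_trigSeries {c : ℤ → ℂ} (hc : Summable fun j => ‖c j‖) :
    Continuous (trigSeries c) :=
  continuous_tsum (fun j => (continuous_expChar j).mul continuous_const) hc
    fun j θ => by simp [norm_expChar]

/-- Termwise integration of an absolutely convergent Fourier series against a continuous
function. -/
theorem hasSum_integral_mul_trigSeries {c : ℤ → ℂ} (hc : Summable fun j => ‖c j‖) {g : ℝ → ℂ}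
    (hg : Continuous g) :
    HasSum (fun j => (∫ θ in (0 : ℝ)..1, g θ * expChar j θ) * c j)
      (∫ θ in (0 : ℝ)..1, g θ * trigSeries c θ) := by
  obtain ⟨M, hM⟩ := (isCompact_uIcc (a := (0 : ℝ)) (b := 1)).exists_bound_of_continuousOn
    hg.continuousOn
  have := intervalIntegral.hasSum_integral_of_dominated_convergence (μ := volume) (a := (0 : ℝ))
    (b := 1) (F := fun j θ => g θ * (expChar j θ * c j)) (f := fun θ => g θ * trigSeries c θ)
    (fun j _ => M * ‖c j‖)
    (fun j => (hg.mul ((continuous_expChar j).mul continuous_const)).aestronglyMeasurable)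
    (fun j => Eventually.of_forall fun θ hθ => by
      rw [norm_mul, norm_mul, norm_expChar, one_mul]
      exact mul_le_mul_of_nonneg_right (hM θ (Set.uIoc_subset_uIcc hθ)) (norm_nonneg _))
    (Eventually.of_forall fun θ _ => hc.mul_left M) (by simp)
    (Eventually.of_forall fun θ _ => (hasSum_trigSeries hc θ).mul_left _)
  refine this.congr_fun fun j => ?_
  simp only [← mul_assoc]
  rw [intervalIntegral.integral_mul_const]

/-- The coefficients of an absolutely convergent Fourier series are recovered by integration. -/
theorem integral_expChar_neg_mul_trigSeries {c : ℤ → ℂ} (hc : Summable fun j => ‖c j‖) (k : ℤ) :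
    ∫ θ in (0 : ℝ)..1, expChar (-k) θ * trigSeries c θ = c k := by
  have h := hasSum_integral_mul_trigSeries hc (continuous_expChar (-k))
  refine h.unique ?_
  convert! hasSum_ite_eq k (c k) using 2 with j
  simp only [← expChar_add, integral_expChar]
  by_cases hj : j = k
  · simp [hj]
  · have : -k + j ≠ 0 := by omega
    simp [hj, this]

/-- Parseval's identity for absolutely convergent Fourier series. -/
theorem integral_norm_sq_trigSeries {c : ℤ → ℂ} (hc : Summable fun j => ‖c j‖) :
    ∫ θ in (0 : ℝ)..1, ‖trigSeries c θ‖ ^ 2 = ∑' j, ‖c j‖ ^ 2 := by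
  have h := hasSum_integral_mul_trigSeries hc
    (Complex.continuous_conj.comp (continuous_trigSeries hc))
  have hcoef : ∀ j, ∫ θ in (0 : ℝ)..1, (starRingEnd ℂ) (trigSeries c θ) * expChar j θ
      = (starRingEnd ℂ) (c j) := by
    intro j
    rw [← integral_expChar_neg_mul_trigSeries hc j, intervalIntegral.integral_of_le zero_le_one,
      intervalIntegral.integral_of_le zero_le_one, ← integral_conj]
    refine integral_congr_ae (Eventually.of_forall fun θ => ?_)
    simp only [map_mul, conj_expChar, neg_neg]
    ring
  simp only [Function.comp_def, hcoef, Complex.conj_mul'] at h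
  have h2 := h.tsum_eq
  apply Complex.ofReal_injective
  rw [Complex.ofReal_tsum, ← intervalIntegral.integral_ofReal]
  push_cast
  exact h2.symm

/-- The shear `(j, k) ↦ (j - k, k)`, which turns a convolution into a product family. -/
def shear : ℤ × ℤ ≃ ℤ × ℤ where
  toFun x := (x.1 - x.2, x.2)
  invFun x := (x.1 + x.2, x.2)
  left_inv x := by simp
  right_inv x := by simp

/-- The convolution of two absolutely summable sequences is absolutely summable, and its Fourier
series is the product of the two Fourier series. -/
theorem summable_and_trigSeries_conv {c d : ℤ → ℂ} (hc : Summable fun j => ‖c j‖)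
    (hd : Summable fun j => ‖d j‖) :
    (Summable fun j : ℤ => ‖∑' k : ℤ, c (j - k) * d k‖) ∧
      ∀ θ : ℝ, trigSeries (fun j : ℤ => ∑' k : ℤ, c (j - k) * d k) θ =
        trigSeries c θ * trigSeries d θ := by
  have hs : Summable fun x : ℤ × ℤ => ‖c (x.1 - x.2) * d x.2‖ := by
    have h := shear.summable_iff.2 (summable_mul_of_summable_norm hc hd).norm
    exact h
  have hj : ∀ j, Summable fun k => ‖c (j - k) * d k‖ := fun j => hs.prod_factor j
  refine ⟨hs.prod.of_nonneg_of_le (fun _ => norm_nonneg _)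
    (fun j => norm_tsum_le_tsum_norm (hj j)), fun θ => ?_⟩
  have hprod : HasSum (fun x : ℤ × ℤ => (expChar x.1 θ * c x.1) * (expChar x.2 θ * d x.2))
      (trigSeries c θ * trigSeries d θ) := by
    have hsum := summable_mul_of_summable_norm (f := fun j => expChar j θ * c j)
      (g := fun j => expChar j θ * d j) (summable_norm_expChar_mul hc θ)
      (summable_norm_expChar_mul hd θ)
    rw [trigSeries, trigSeries, tsum_mul_tsum_of_summable_norm (summable_norm_expChar_mul hc θ)
      (summable_norm_expChar_mul hd θ)]
    exact hsum.hasSum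
  have hprod' : HasSum (fun x : ℤ × ℤ => expChar x.1 θ * (c (x.1 - x.2) * d x.2))
      (trigSeries c θ * trigSeries d θ) := by
    refine (shear.hasSum_iff.2 hprod).congr_fun fun x => ?_
    have : expChar x.1 θ = expChar (x.1 - x.2) θ * expChar x.2 θ := by
      rw [← expChar_add, sub_add_cancel]
    rw [this]
    simp only [shear, Function.comp, Equiv.coe_fn_mk]
    ring
  have := hprod'.prod_fiberwise fun j => ((hj j).of_norm.hasSum).mul_left (expChar j θ)
  exact this.tsum_eq

/-! ### The second joint cumulant is the covariance -/

/-- The second derivative of `log φ` at a point `x` with `φ x = 1`. The first derivatives of `φ` are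
written as `iteratedFDeriv ℝ 1`, the form in which moments of a law are read off from its
characteristic function. -/
theorem iteratedFDeriv_two_clog {E : Type*} [NormedAddCommGroup E] [NormedSpace ℝ E]
    {φ : E → ℂ} (hφ : ContDiff ℝ 2 φ) {x : E} (hx : φ x = 1) (m : Fin 2 → E) :
    iteratedFDeriv ℝ 2 (fun t => Complex.log (φ t)) x m =
      iteratedFDeriv ℝ 2 φ x m -
        iteratedFDeriv ℝ 1 φ x (fun _ => m 0) * iteratedFDeriv ℝ 1 φ x (fun _ => m 1) := by
  have hd : Differentiable ℝ φ := hφ.differentiable (by norm_num)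
  have hd' : Differentiable ℝ (fderiv ℝ φ) :=
    (hφ.fderiv_right (m := 1) (by norm_num)).differentiable (by norm_num)
  have hslit : ∀ᶠ t in 𝓝 x, φ t ∈ Complex.slitPlane :=
    hd.continuous.continuousAt.eventually
      (Complex.isOpen_slitPlane.mem_nhds (by rw [hx]; exact Complex.one_mem_slitPlane))
  have hlog : fderiv ℝ (fun t => Complex.log (φ t)) =ᶠ[𝓝 x] fun t => (φ t)⁻¹ • fderiv ℝ φ t := by
    filter_upwards [hslit] with t ht
    have h := (((Complex.hasStrictDerivAt_log ht).hasDerivAt.hasFDerivAt).restrictScalars ℝ).comp t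
      (hd t).hasFDerivAt
    refine HasFDerivAt.fderiv (h.congr_fderiv ?_)
    ext v
    simp [mul_comm]
  have hinv : HasFDerivAt (fun t => (φ t)⁻¹) (-(fderiv ℝ φ x)) x := by
    have h := (((hasDerivAt_inv (x := φ x) (by rw [hx]; exact one_ne_zero)).hasFDerivAt
      ).restrictScalars ℝ).comp x (hd x).hasFDerivAt
    refine h.congr_fderiv ?_
    ext v
    simp [hx]
  have h2 : fderiv ℝ (fun t => (φ t)⁻¹ • fderiv ℝ φ t) x = _ :=
    (hinv.smul (hd' x).hasFDerivAt).fderiv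
  rw [iteratedFDeriv_two_apply, hlog.fderiv_eq, iteratedFDeriv_two_apply,
    iteratedFDeriv_one_apply, iteratedFDeriv_one_apply, h2]
  simp [hx]
  ring

/-- For square integrable random variables the joint cumulant of two variables is their
covariance. -/
theorem jointCumulant_two {Ω : Type*} [MeasurableSpace Ω] (μ : Measure Ω) [IsProbabilityMeasure μ]
    (X : Fin 2 → Ω → ℝ) (hm : ∀ i, Measurable (X i)) (hX : ∀ i, MemLp (X i) 2 μ) :
    jointCumulant μ X = (covariance (X 0) (X 1) μ : ℂ) := by
  set V : Ω → EuclideanSpace ℝ (Fin 2) := fun ω => WithLp.toLp 2 fun j => X j ω with hV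
  have hVm : Measurable V := (WithLp.measurable_toLp 2 _).comp (measurable_pi_lambda _ hm)
  have hVL : MemLp V 2 μ := MemLp.of_eval_piLp fun i => hX i
  have : IsProbabilityMeasure (μ.map V) := Measure.isProbabilityMeasure_map hVm.aemeasurable
  have hint : MemLp id ((2 : ℕ) : ℝ≥0∞) (μ.map V) := by
    rw [memLp_map_measure_iff (by fun_prop) hVm.aemeasurable]
    exact hVL
  have hint1 : MemLp id ((1 : ℕ) : ℝ≥0∞) (μ.map V) := hint.mono_exponent (by norm_num)
  have h0 : charFun (μ.map V) 0 = 1 := by simp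
  rw [jointCumulant, iteratedFDeriv_two_clog (contDiff_charFun hint) h0,
    iteratedFDeriv_charFun hint, iteratedFDeriv_charFun hint1, iteratedFDeriv_charFun hint1,
    covariance_eq_sub (hX 0) (hX 1)]
  simp only [inner_zero_right, EuclideanSpace.inner_single_right, Complex.ofReal_zero, zero_mul,
    Complex.exp_zero, mul_one, Fin.prod_univ_two, Finset.univ_unique, Finset.prod_singleton,
    conj_trivial, one_mul, pow_one]
  rw [integral_map hVm.aemeasurable (by fun_prop), integral_map hVm.aemeasurable (by fun_prop),
    integral_map hVm.aemeasurable (by fun_prop)]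
  simp only [hV, integral_complex_ofReal, Pi.mul_apply, Complex.I_sq]
  push_cast
  linear_combination
    (((∫ x, X 0 x ∂μ : ℝ) : ℂ) * ((∫ x, X 1 x ∂μ : ℝ) : ℂ)) * Complex.I_sq

/-! ### The spectral density and its law -/

/-- For even `R` the Fourier series is real, so that no information is lost in the real part taken in
`spectralDensity`. -/
theorem trigSeries_eq_spectralDensity {R : ℤ → ℝ} (hR : Summable fun j => |R j|)
    (heven : ∀ j, R (-j) = R j) (θ : ℝ) :
    trigSeries (fun j => (R j : ℂ)) θ = (spectralDensity R θ : ℂ) := by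
  have hR' : Summable fun j => ‖(R j : ℂ)‖ := by simpa using hR
  symm
  change (((trigSeries (fun j => (R j : ℂ)) θ).re : ℝ) : ℂ) = _
  rw [← Complex.conj_eq_iff_re]
  have h := hasSum_trigSeries hR' θ
  have h1 := h.map (starRingEnd ℂ) Complex.continuous_conj
  have h2 := ((Equiv.neg ℤ).hasSum_iff).2 h
  refine h1.unique (h2.congr_fun fun j => ?_)
  simp [conj_expChar, heven]

theorem continuous_spectralDensity {R : ℤ → ℝ} (hR : Summable fun j => |R j|) :
    Continuous (spectralDensity R) :=
  Complex.continuous_re.comp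
    (continuous_trigSeries (c := fun j => (R j : ℂ)) (by simpa using hR))

theorem abs_spectralDensity_le {R : ℤ → ℝ} (hR : Summable fun j => |R j|) (θ : ℝ) :
    |spectralDensity R θ| ≤ ∑' j, |R j| := by
  have := norm_trigSeries_le (c := fun j => (R j : ℂ)) (by simpa using hR) θ
  simp only [Complex.norm_real, Real.norm_eq_abs] at this
  exact (Complex.abs_re_le_norm _).trans this

theorem integral_spectralLaw {R : ℤ → ℝ} (hR : Summable fun j => |R j|) {g : ℝ → ℝ}
    (hg : Continuous g) :
    ∫ x, g x ∂(spectralLaw R) = ∫ θ in (0 : ℝ)..1, g (spectralDensity R θ) := by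
  rw [spectralLaw, integral_map (continuous_spectralDensity hR).aemeasurable
    hg.aestronglyMeasurable, intervalIntegral.integral_of_le zero_le_one,
    integral_Icc_eq_integral_Ioc]

theorem integrable_spectralLaw {R : ℤ → ℝ} (hR : Summable fun j => |R j|) {g : ℝ → ℝ}
    (hg : Continuous g) : Integrable g (spectralLaw R) := by
  rw [spectralLaw, integrable_map_measure hg.aestronglyMeasurable
    (continuous_spectralDensity hR).aemeasurable]
  exact (hg.comp (continuous_spectralDensity hR)).continuousOn.integrableOn_compact isCompact_Icc

/-- The Fourier series of the `k`-th convolution power is the `k`-th power of the Fourier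
series. -/
theorem trigSeries_convPow {R : ℤ → ℝ} (hR : Summable fun j => |R j|) (k : ℕ) :
    (Summable fun j => ‖(convPow R k j : ℂ)‖) ∧
      ∀ θ, trigSeries (fun j => (convPow R k j : ℂ)) θ =
        trigSeries (fun j => (R j : ℂ)) θ ^ k := by
  have hR' : Summable fun j => ‖(R j : ℂ)‖ := by simpa using hR
  induction k with
  | zero =>
    constructor
    · refine (hasSum_ite_eq (0 : ℤ) (1 : ℝ)).summable.congr fun j => ?_
      by_cases hj : j = 0 <;> simp [convPow, hj]
    · intro θ
      rw [trigSeries, tsum_eq_single 0]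
      · simp [convPow, expChar_zero]
      · intro j hj
        simp [convPow, hj]
  | succ k ih =>
    have h := summable_and_trigSeries_conv hR' ih.1
    have hconv : ∀ j, (convPow R (k + 1) j : ℂ) = ∑' l, (R (j - l) : ℂ) * (convPow R k l : ℂ) := by
      intro j
      rw [convPow, Complex.ofReal_tsum]
      simp
    simp only [hconv]
    refine ⟨h.1, fun θ => ?_⟩
    rw [h.2, ih.2, pow_succ']

theorem integral_pow_spectralLaw {R : ℤ → ℝ} (hR : Summable fun j => |R j|)
    (heven : ∀ j, R (-j) = R j) (k : ℕ) :
    ∫ x, x ^ k ∂(spectralLaw R) = convPow R k 0 := by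
  obtain ⟨hs, ht⟩ := trigSeries_convPow hR k
  have h := integral_expChar_neg_mul_trigSeries hs 0
  rw [integral_spectralLaw hR (continuous_pow k)]
  apply Complex.ofReal_injective
  rw [← h, ← intervalIntegral.integral_ofReal]
  refine intervalIntegral.integral_congr fun θ _ => ?_
  simp [expChar_zero, ht, trigSeries_eq_spectralDensity hR heven]

/-! ### Comparing a symmetric matrix with a Laurent operator -/

section Eigen

variable {p : ℕ} {Y : Matrix (Fin p) (Fin p) ℝ} (hY : Y.IsHermitian)

/-- The weight `|⟨u_j, z⟩|²` that the complex vector `z` puts on the `j`-th eigenvector `u_j` of a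
real symmetric matrix. -/
def eigenWeight (j : Fin p) (z : Fin p → ℂ) : ℝ :=
  ‖∑ i, (hY.eigenvectorBasis j i : ℂ) * z i‖ ^ 2

theorem eigenWeight_nonneg (j : Fin p) (z : Fin p → ℂ) : 0 ≤ eigenWeight hY j z := by
  unfold eigenWeight; positivity

/-- Bessel's equality for a real orthonormal basis and a complex vector, obtained from the real and
imaginary parts. -/
theorem sum_eigenWeight (z : Fin p → ℂ) : ∑ j, eigenWeight hY j z = ∑ i, ‖z i‖ ^ 2 := by
  have key : ∀ a : Fin p → ℝ,
      ∑ j, (∑ i, hY.eigenvectorBasis j i * a i) ^ 2 = ∑ i, a i ^ 2 := by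
    intro a
    have h := hY.eigenvectorBasis.sum_sq_norm_inner_right (WithLp.toLp 2 a)
    rw [EuclideanSpace.real_norm_sq_eq] at h
    rw [← h]
    refine Finset.sum_congr rfl fun j _ => ?_
    rw [Real.norm_eq_abs, sq_abs, PiLp.inner_apply]
    simp [mul_comm]
  have hsq : ∀ w : ℂ, ‖w‖ ^ 2 = w.re ^ 2 + w.im ^ 2 := fun w => by
    rw [Complex.sq_norm, Complex.normSq_apply]; ring
  simp only [eigenWeight, hsq, Finset.sum_add_distrib, Complex.re_sum, Complex.im_sum,
    Complex.re_ofReal_mul, Complex.im_ofReal_mul, key]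

/-- The second moment of the eigenvalues about `x`, under the weights of `z`, is `‖Y z - x z‖²`. -/
theorem sum_eigenWeight_mul_sq (z : Fin p → ℂ) (x : ℝ) :
    ∑ j, eigenWeight hY j z * (hY.eigenvalues j - x) ^ 2 =
      ∑ i, ‖∑ k, (Y i k : ℂ) * z k - x * z i‖ ^ 2 := by
  rw [← sum_eigenWeight hY]
  refine Finset.sum_congr rfl fun j _ => ?_
  have h : ∑ i, (hY.eigenvectorBasis j i : ℂ) * (∑ k, (Y i k : ℂ) * z k - x * z i) =
      ((hY.eigenvalues j - x : ℝ) : ℂ) * ∑ i, (hY.eigenvectorBasis j i : ℂ) * z i := by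
    have hev : ∀ k, ∑ i, (hY.eigenvectorBasis j i : ℂ) * (Y i k : ℂ) =
        (hY.eigenvalues j : ℂ) * (hY.eigenvectorBasis j k : ℂ) := by
      intro k
      have h1 := congrFun (hY.mulVec_eigenvectorBasis j) k
      simp only [Matrix.mulVec, dotProduct, Pi.smul_apply, smul_eq_mul] at h1
      rw [← Complex.ofReal_mul, ← h1]
      push_cast
      refine Finset.sum_congr rfl fun i _ => ?_
      rw [← hY.apply i k, star_trivial, mul_comm]
    simp only [mul_sub, Finset.sum_sub_distrib, Finset.mul_sum]
    rw [Finset.sum_comm]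
    simp only [← mul_assoc, ← Finset.sum_mul, hev]
    push_cast
    simp only [sub_mul, ← Finset.sum_sub_distrib]
    refine Finset.sum_congr rfl fun i _ => ?_
    ring
  rw [eigenWeight, eigenWeight, h, norm_mul, mul_pow, Complex.norm_real, Real.norm_eq_abs, sq_abs,
    mul_comm]

end Eigen

/-- Extension by zero to `ℤ` of a vector indexed by `{0, …, p - 1}`. -/
def zeroExtend {p : ℕ} (a : Fin p → ℝ) (l : ℤ) : ℝ :=
  ∑ k : Fin p, if l = (k : ℤ) then a k else 0

theorem zeroExtend_coe {p : ℕ} (a : Fin p → ℝ) (k : Fin p) : zeroExtend a k = a k := by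
  simp [zeroExtend, ← Fin.ext_iff]

theorem zeroExtend_of_notMem_range {p : ℕ} (a : Fin p → ℝ) {l : ℤ}
    (hl : l ∉ Set.range fun k : Fin p => (k : ℤ)) : zeroExtend a l = 0 :=
  Finset.sum_eq_zero fun k _ => if_neg fun h => hl ⟨k, h.symm⟩

theorem injective_coe_int (p : ℕ) : Function.Injective fun k : Fin p => (k : ℤ) :=
  fun k l h => Fin.ext (by simpa using h)

theorem summable_abs_zeroExtend {p : ℕ} (a : Fin p → ℝ) : Summable fun l => |zeroExtend a l| := by
  refine (summable_sum (s := Finset.univ) (f := fun (k : Fin p) (l : ℤ) =>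
    if l = (k : ℤ) then a k else 0) fun k _ => (hasSum_ite_eq _ _).summable).abs

theorem hasSum_expChar_mul_zeroExtend {p : ℕ} (a : Fin p → ℝ) (θ : ℝ) :
    HasSum (fun l => expChar l θ * (zeroExtend a l : ℂ))
      (∑ k : Fin p, (a k : ℂ) * expChar k θ) := by
  have h : HasSum (fun l : ℤ => ∑ k : Fin p, if l = (k : ℤ) then (a k : ℂ) * expChar k θ else 0)
      (∑ k : Fin p, (a k : ℂ) * expChar k θ) :=
    hasSum_sum fun k _ => hasSum_ite_eq _ _
  refine h.congr_fun fun l => ?_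
  rw [zeroExtend]
  push_cast
  rw [Finset.mul_sum]
  refine Finset.sum_congr rfl fun k _ => ?_
  split_ifs with h
  · rw [h, mul_comm]
  · simp

theorem hasSum_zeroExtend {p : ℕ} (a : Fin p → ℝ) : HasSum (zeroExtend a) (∑ k, a k) := by
  refine ((injective_coe_int p).hasSum_iff fun l hl => zeroExtend_of_notMem_range a hl).1 ?_
  simpa only [Function.comp_def, zeroExtend_coe] using hasSum_fintype a

theorem hasSum_zeroExtend_sq {p : ℕ} (a : Fin p → ℝ) :
    HasSum (fun l => zeroExtend a l ^ 2) (∑ k, a k ^ 2) := by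
  refine ((injective_coe_int p).hasSum_iff fun l hl => ?_).1 ?_
  · rw [zeroExtend_of_notMem_range a hl]; simp
  · simpa only [Function.comp_def, zeroExtend_coe] using hasSum_fintype _

/-- The `i`-th row of the difference between the `p × p` matrix `Y`, extended by zero to columns
indexed by `ℤ`, and the Laurent (bi-infinite Toeplitz) matrix with entries `R (i - l)`. -/
def rowDefect {p : ℕ} (Y : Matrix (Fin p) (Fin p) ℝ) (R : ℤ → ℝ) (i : Fin p) (l : ℤ) : ℝ :=
  zeroExtend (fun k => Y i k) l - R ((i : ℤ) - l)

/-- The squared Hilbert–Schmidt norm of the `p × ℤ` matrix `rowDefect Y R`. -/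
def laurentDefect {p : ℕ} (Y : Matrix (Fin p) (Fin p) ℝ) (R : ℤ → ℝ) : ℝ :=
  ∑ i : Fin p, ∑' l : ℤ, rowDefect Y R i l ^ 2

theorem summable_abs_comp_sub {R : ℤ → ℝ} (hR : Summable fun j => |R j|) (i : ℤ) :
    Summable fun l => |R (i - l)| :=
  (Equiv.subLeft i).summable_iff.2 hR

theorem summable_rowDefect {p : ℕ} (Y : Matrix (Fin p) (Fin p) ℝ) {R : ℤ → ℝ}
    (hR : Summable fun j => |R j|) (i : Fin p) : Summable fun l => |rowDefect Y R i l| :=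
  ((summable_abs_zeroExtend fun k => Y i k).add (summable_abs_comp_sub hR i)).of_nonneg_of_le
    (fun _ => abs_nonneg _) fun _ => abs_sub _ _

/-- The Fourier series of a row defect measures how far the exponentials are from being
eigenvectors of `Y` with eigenvalue the spectral density. -/
theorem trigSeries_rowDefect {p : ℕ} (Y : Matrix (Fin p) (Fin p) ℝ) {R : ℤ → ℝ}
    (hR : Summable fun j => |R j|) (heven : ∀ j, R (-j) = R j) (i : Fin p) (θ : ℝ) :
    trigSeries (fun l => (rowDefect Y R i l : ℂ)) θ =
      ∑ k : Fin p, (Y i k : ℂ) * expChar k θ - spectralDensity R θ * expChar i θ := by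
  refine HasSum.tsum_eq ?_
  have h2 : HasSum (fun l : ℤ => expChar l θ * (R ((i : ℤ) - l) : ℂ))
      (spectralDensity R θ * expChar i θ) := by
    have h := hasSum_trigSeries (c := fun j => (R j : ℂ)) (by simpa using hR) θ
    rw [trigSeries_eq_spectralDensity hR heven] at h
    refine (((Equiv.subRight (i : ℤ)).hasSum_iff.2 h).mul_right (expChar i θ)).congr_fun
      fun l => ?_
    have hl : expChar l θ = expChar (l - i) θ * expChar i θ := by
      rw [← expChar_add, sub_add_cancel]
    have hRl : R ((i : ℤ) - l) = R (l - i) := by rw [← heven, neg_sub]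
    simp only [Function.comp, Equiv.subRight_apply, hRl]
    rw [hl]; ring
  refine ((hasSum_expChar_mul_zeroExtend (fun k => Y i k) θ).sub h2).congr_fun fun l => ?_
  simp only [rowDefect, Complex.ofReal_sub, mul_sub]

theorem integral_norm_sq_rowDefect {p : ℕ} (Y : Matrix (Fin p) (Fin p) ℝ) {R : ℤ → ℝ}
    (hR : Summable fun j => |R j|) (heven : ∀ j, R (-j) = R j) (i : Fin p) :
    ∫ θ in (0 : ℝ)..1, ‖∑ k : Fin p, (Y i k : ℂ) * expChar k θ
        - spectralDensity R θ * expChar i θ‖ ^ 2 = ∑' l, rowDefect Y R i l ^ 2 := by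
  have h := integral_norm_sq_trigSeries (c := fun l => (rowDefect Y R i l : ℂ))
    (by simpa using summable_rowDefect Y hR i)
  simp only [trigSeries_rowDefect Y hR heven, Complex.norm_real, Real.norm_eq_abs, sq_abs] at h
  exact h

/-- On average over the frequency, each eigenvector carries the same weight. -/
theorem integral_eigenWeight {p : ℕ} {Y : Matrix (Fin p) (Fin p) ℝ} (hY : Y.IsHermitian)
    (j : Fin p) :
    ∫ θ in (0 : ℝ)..1, eigenWeight hY j (fun i => expChar i θ) = 1 := by
  have h := integral_norm_sq_trigSeries
    (c := fun l => (zeroExtend (hY.eigenvectorBasis j) l : ℂ))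
    (by simpa using summable_abs_zeroExtend _)
  have hnorm : ∑ k, hY.eigenvectorBasis j k ^ 2 = 1 := by
    rw [← EuclideanSpace.real_norm_sq_eq, hY.eigenvectorBasis.norm_eq_one, one_pow]
  simp only [trigSeries, (hasSum_expChar_mul_zeroExtend _ _).tsum_eq, Complex.norm_real,
    Real.norm_eq_abs, sq_abs, (hasSum_zeroExtend_sq _).tsum_eq] at h
  exact h.trans hnorm

theorem continuous_eigenWeight {p : ℕ} {Y : Matrix (Fin p) (Fin p) ℝ} (hY : Y.IsHermitian)
    (j : Fin p) : Continuous fun θ => eigenWeight hY j fun i => expChar i θ := by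
  have := fun i : Fin p => continuous_expChar i
  unfold eigenWeight
  fun_prop

/-- If `f` varies by at most `ε + C (x - y)²` from the range of the spectral density, then the
linear eigenvalue statistic `∑ f(λ_j)` is within `p ε + C · laurentDefect Y R` of `p ∫ f dν`, where
`ν` is the law of the spectral density. -/
theorem abs_sum_eigenvalues_sub_le {p : ℕ} {Y : Matrix (Fin p) (Fin p) ℝ} (hY : Y.IsHermitian)
    {R : ℤ → ℝ} (hR : Summable fun j => |R j|) (heven : ∀ j, R (-j) = R j) {f : ℝ → ℝ}
    (hf : Continuous f) {ε C : ℝ}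
    (hC : ∀ x θ, |f x - f (spectralDensity R θ)| ≤ ε + C * (x - spectralDensity R θ) ^ 2) :
    |∑ j, f (hY.eigenvalues j) - p * ∫ x, f x ∂(spectralLaw R)| ≤
      p * ε + C * laurentDefect Y R := by
  set w : Fin p → ℝ → ℝ := fun j θ => eigenWeight hY j fun i => expChar i θ with hw
  have hwc : ∀ j, Continuous (w j) := continuous_eigenWeight hY
  have hwsum : ∀ θ, ∑ j, w j θ = p := fun θ => by
    simp [hw, sum_eigenWeight, norm_expChar]
  have hSc := continuous_spectralDensity hR
  have hec := fun i : Fin p => continuous_expChar i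
  -- `w j θ dθ` has total mass 1 for each `j` and sums to `p` for each `θ`: up to the factor `p` it
  -- couples the empirical eigenvalue measure with the law of the spectral density
  have hcoupling : ∑ j, f (hY.eigenvalues j) - p * ∫ x, f x ∂(spectralLaw R) =
      ∫ θ in (0 : ℝ)..1, ∑ j, w j θ * (f (hY.eigenvalues j) - f (spectralDensity R θ)) := by
    have h1 : ∀ j, f (hY.eigenvalues j) = ∫ θ in (0 : ℝ)..1, w j θ * f (hY.eigenvalues j) :=
      fun j => by rw [intervalIntegral.integral_mul_const, integral_eigenWeight, one_mul]
    rw [integral_spectralLaw hR hf, ← intervalIntegral.integral_const_mul,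
      Finset.sum_congr rfl fun j _ => h1 j, ← intervalIntegral.integral_finsetSum
        (fun j _ => Continuous.intervalIntegrable (by fun_prop) _ _),
      ← intervalIntegral.integral_sub (Continuous.intervalIntegrable (by fun_prop) _ _)
        (Continuous.intervalIntegrable (by fun_prop) _ _)]
    refine intervalIntegral.integral_congr fun θ _ => ?_
    simp only [mul_sub, Finset.sum_sub_distrib, ← Finset.sum_mul, hwsum]
  have hbound : ∀ θ, |∑ j, w j θ * (f (hY.eigenvalues j) - f (spectralDensity R θ))| ≤
      p * ε + C * ∑ i : Fin p, ‖∑ k : Fin p, (Y i k : ℂ) * expChar k θ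
        - spectralDensity R θ * expChar i θ‖ ^ 2 := by
    intro θ
    rw [← sum_eigenWeight_mul_sq hY, ← hwsum θ, Finset.sum_mul, Finset.mul_sum,
      ← Finset.sum_add_distrib]
    refine (Finset.abs_sum_le_sum_abs _ _).trans (Finset.sum_le_sum fun j _ => ?_)
    have hwj : 0 ≤ w j θ := eigenWeight_nonneg hY j _
    rw [abs_mul, abs_of_nonneg hwj]
    refine (mul_le_mul_of_nonneg_left (hC _ θ) hwj).trans_eq ?_
    simp only [hw]
    ring
  rw [hcoupling]
  refine (intervalIntegral.abs_integral_le_integral_abs zero_le_one).trans ?_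
  refine (intervalIntegral.integral_mono_on zero_le_one
    (Continuous.intervalIntegrable (by fun_prop) _ _)
    (Continuous.intervalIntegrable (by fun_prop) _ _) fun θ _ => hbound θ).trans_eq ?_
  rw [intervalIntegral.integral_add (by simp) (Continuous.intervalIntegrable (by fun_prop) _ _),
    intervalIntegral.integral_const_mul C, intervalIntegral.integral_finsetSum
      fun i _ => Continuous.intervalIntegrable (by fun_prop) _ _]
  simp only [integral_norm_sq_rowDefect Y hR heven, laurentDefect,
    intervalIntegral.integral_const, sub_zero, one_smul]

/-- A bounded continuous function has increments from a bounded set controlled by a constant plus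
a multiple of the squared distance. -/
theorem exists_abs_sub_le_add_mul_sq (f : ℝ →ᵇ ℝ) (M : ℝ) {ε : ℝ} (hε : 0 < ε) :
    ∃ C, 0 ≤ C ∧ ∀ x y, |y| ≤ M → |f x - f y| ≤ ε + C * (x - y) ^ 2 := by
  have hu := (isCompact_Icc (a := -M) (b := M)).uniformContinuousAt_of_continuousAt f
    (fun y _ => f.continuous.continuousAt) (Metric.dist_mem_uniformity hε)
  obtain ⟨δ, hδ, h⟩ := Metric.mem_uniformity_dist.1 hu
  refine ⟨2 * ‖f‖ / δ ^ 2, by positivity, fun x y hy => ?_⟩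
  by_cases hxy : |y - x| < δ
  · have h1 := h (a := y) (b := x) hxy (abs_le.1 hy)
    have h2 : |f y - f x| < ε := h1
    rw [abs_sub_comm]
    have : 0 ≤ 2 * ‖f‖ / δ ^ 2 * (x - y) ^ 2 := by positivity
    linarith
  · have h1 : δ ^ 2 ≤ (x - y) ^ 2 := by
      rw [← sq_abs (x - y), abs_sub_comm]
      exact pow_le_pow_left₀ hδ.le (not_lt.1 hxy) 2
    have h2 : |f x - f y| ≤ 2 * ‖f‖ := f.dist_le_two_norm x y
    have h3 : 2 * ‖f‖ ≤ 2 * ‖f‖ / δ ^ 2 * (x - y) ^ 2 := by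
      rw [div_mul_eq_mul_div, le_div_iff₀ (by positivity)]
      exact mul_le_mul_of_nonneg_left h1 (by positivity)
    linarith

/-! ### Moments and covariances of a stationary sequence and of its copies -/

/-- The empirical covariance `n⁻¹ ∑_{a < n} W a i * W a k` of the coordinates `i` and `k`. The mean is
not subtracted, since the sequence is centred. -/
def empiricalCov {Ω : Type*} (W : ℕ → ℤ → Ω → ℝ) (n : ℕ) (i k : ℤ) (ω : Ω) : ℝ :=
  (n : ℝ)⁻¹ * ∑ a ∈ Finset.range n, W a i ω * W a k ω

theorem transpose_mul_dataMatrix_apply {Ω : Type*} (W : ℕ → ℤ → Ω → ℝ) (n p : ℕ) (ω : Ω)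
    (i k : Fin p) :
    ((dataMatrix W n p ω).transpose * dataMatrix W n p ω) i k =
      empiricalCov W n ((i : ℤ) + 1) ((k : ℤ) + 1) ω := by
  simp only [empiricalCov, Matrix.mul_apply, Matrix.transpose_apply, dataMatrix, Matrix.of_apply]
  rw [Finset.mul_sum, ← Fin.sum_univ_eq_sum_range
    (fun a => (n : ℝ)⁻¹ * (W a ((i : ℤ) + 1) ω * W a ((k : ℤ) + 1) ω))]
  refine Finset.sum_congr rfl fun a _ => ?_
  rw [div_mul_div_comm, Real.mul_self_sqrt (Nat.cast_nonneg n), div_eq_inv_mul]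

section Stationary

variable {Ω₀ Ω : Type*} [MeasurableSpace Ω₀] [MeasurableSpace Ω] {μ : Measure Ω₀}
  {P : Measure Ω} {Z : ℤ → Ω₀ → ℝ} {W : ℕ → ℤ → Ω → ℝ}

theorem IsStationary.identDistrib (hZ : IsStationary μ Z) (j : ℤ) :
    IdentDistrib (Z j) (Z 0) μ μ := by
  simpa [Function.comp_def] using (hZ.shift j).comp (measurable_pi_apply 0)

theorem IsStationary.identDistrib_mul (hZ : IsStationary μ Z) (i j m : ℤ) :
    IdentDistrib (fun ω => Z (i + m) ω * Z (j + m) ω) (fun ω => Z i ω * Z j ω) μ μ :=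
  (hZ.shift m).comp ((measurable_pi_apply i).mul (measurable_pi_apply j))

theorem IsIIDCopies.identDistrib_mul (hW : IsIIDCopies μ Z P W) (a : ℕ) (i j : ℤ) :
    IdentDistrib (fun ω => W a i ω * W a j ω) (fun ω => Z i ω * Z j ω) P μ :=
  (hW.identDistrib a).comp ((measurable_pi_apply i).mul (measurable_pi_apply j))

theorem memLp_of_moments [IsProbabilityMeasure μ] (hZ : IsStationary μ Z)
    (hZc : HasSummableCumulants μ Z) (k : ℕ) (hk : 1 ≤ k) (j : ℤ) : MemLp (Z j) k μ := by
  rw [(hZ.identDistrib j).memLp_iff,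
    ← integrable_norm_rpow_iff (hZ.measurable 0).aestronglyMeasurable (by simp; omega) (by simp)]
  simpa using hZc.moments k hk

theorem integral_mul_eq_covSeq [IsProbabilityMeasure μ] (hZ : IsStationary μ Z)
    (hZc : HasSummableCumulants μ Z) (i j : ℤ) :
    ∫ ω, Z i ω * Z j ω ∂μ = covSeq μ Z (j - i) := by
  have h2 : ∀ j, MemLp (Z j) 2 μ := fun j => memLp_of_moments hZ hZc 2 (by norm_num) j
  rw [covSeq, covariance_eq_sub (h2 _) (h2 _), hZc.mean_zero, zero_mul, sub_zero]
  have := (hZ.identDistrib_mul 0 (j - i) i).integral_eq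
  simpa using this

theorem covSeq_neg [IsProbabilityMeasure μ] (hZ : IsStationary μ Z)
    (hZc : HasSummableCumulants μ Z) (j : ℤ) : covSeq μ Z (-j) = covSeq μ Z j := by
  have h1 := integral_mul_eq_covSeq hZ hZc j 0
  have h2 := integral_mul_eq_covSeq hZ hZc 0 j
  rw [zero_sub] at h1
  rw [sub_zero] at h2
  rw [← h1, ← h2]
  simp only [mul_comm]

/-- The case `r = 1` of the cumulant condition is the summability of the covariances. -/
theorem summable_covSeq [IsProbabilityMeasure μ] (hZ : IsStationary μ Z)
    (hZc : HasSummableCumulants μ Z) : Summable fun j => |covSeq μ Z j| := by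
  have h := hZc.summable 1 le_rfl
  rw [← (Equiv.funUnique (Fin 1) ℤ).summable_iff]
  refine h.congr fun j => ?_
  rw [jointCumulant_two μ _ (fun _ => hZ.measurable _)
    fun _ => memLp_of_moments hZ hZc 2 (by norm_num) _]
  simp [covSeq, Fin.cons_one]

theorem memLp_mul_copies [IsProbabilityMeasure μ] (hZ : IsStationary μ Z)
    (hZc : HasSummableCumulants μ Z) (hW : IsIIDCopies μ Z P W) (a : ℕ) (i j : ℤ) :
    MemLp (fun ω => W a i ω * W a j ω) 2 P := by
  have h4 : ∀ j, MemLp (Z j) 4 μ := fun j => memLp_of_moments hZ hZc 4 (by norm_num) j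
  rw [(hW.identDistrib_mul a i j).memLp_iff]
  have : ENNReal.HolderTriple 4 4 2 := ⟨by
    rw [← two_mul, show (4 : ℝ≥0∞) = 2 * 2 by norm_num, ENNReal.mul_inv (by simp) (by simp),
      ← mul_assoc, ENNReal.mul_inv_cancel (by simp) (by simp), one_mul]⟩
  exact (h4 j).mul (h4 i)

/-- By stationarity and `x² y² ≤ (x⁴ + y⁴) / 2`, the variance of a product of two coordinates is at
most the fourth moment. -/
theorem variance_mul_copies_le [IsProbabilityMeasure μ] [IsProbabilityMeasure P]
    (hZ : IsStationary μ Z)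
    (hZc : HasSummableCumulants μ Z) (hW : IsIIDCopies μ Z P W) (a : ℕ) (i j : ℤ) :
    variance (fun ω => W a i ω * W a j ω) P ≤ ∫ ω, Z 0 ω ^ 4 ∂μ := by
  have h4 : ∀ j, Integrable (fun ω => Z j ω ^ 4) μ := fun j => by
    have h := (memLp_of_moments hZ hZc 4 (by norm_num) j).integrable_norm_pow (by norm_num)
    simpa [Even.pow_abs (n := 4) (by decide)] using h
  have hint : ∀ j, ∫ ω, Z j ω ^ 4 ∂μ = ∫ ω, Z 0 ω ^ 4 ∂μ := fun j =>
    ((hZ.identDistrib j).comp (measurable_id.pow_const 4)).integral_eq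
  rw [(hW.identDistrib_mul a i j).variance_eq]
  refine (variance_le_expectation_sq
    ((hZ.measurable i).mul (hZ.measurable j)).aestronglyMeasurable).trans ?_
  have h2 : ∫ ω, Z 0 ω ^ 4 ∂μ = ∫ ω, (Z i ω ^ 4 + Z j ω ^ 4) / 2 ∂μ := by
    rw [integral_div, integral_add (h4 i) (h4 j), hint i, hint j]; ring
  rw [h2]
  refine integral_mono_of_nonneg (Eventually.of_forall fun ω => sq_nonneg _)
    (((h4 i).add (h4 j)).div_const 2) (Eventually.of_forall fun ω => ?_)
  simp only [Pi.pow_apply, Pi.mul_apply]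
  nlinarith [sq_nonneg (Z i ω ^ 2 - Z j ω ^ 2)]

theorem memLp_empiricalCov [IsProbabilityMeasure μ] (hZ : IsStationary μ Z)
    (hZc : HasSummableCumulants μ Z) (hW : IsIIDCopies μ Z P W) (n : ℕ) (i k : ℤ) :
    MemLp (empiricalCov W n i k) 2 P :=
  (memLp_finsetSum _ fun a _ => memLp_mul_copies hZ hZc hW a i k).const_mul _

/-- Averaging `n` independent copies gives covariance estimates with mean squared error of
order `1 / n`. -/
theorem integral_empiricalCov_sub_sq_le [IsProbabilityMeasure μ] [IsProbabilityMeasure P]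
    (hZ : IsStationary μ Z) (hZc : HasSummableCumulants μ Z) (hW : IsIIDCopies μ Z P W)
    {n : ℕ} (hn : 0 < n) (i k : ℤ) :
    ∫ ω, (empiricalCov W n i k ω - covSeq μ Z (i - k)) ^ 2 ∂P ≤ (∫ ω, Z 0 ω ^ 4 ∂μ) / n := by
  have hn' : (n : ℝ) ≠ 0 := by positivity
  have hL := fun a => memLp_mul_copies hZ hZc hW a i k
  have hmean : ∫ ω, empiricalCov W n i k ω ∂P = covSeq μ Z (i - k) := by
    simp only [empiricalCov]
    rw [integral_const_mul, integral_finsetSum _ fun a _ => (hL a).integrable (by norm_num)]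
    simp only [fun a => (hW.identDistrib_mul a i k).integral_eq, integral_mul_eq_covSeq hZ hZc]
    rw [← covSeq_neg hZ hZc, neg_sub]
    simp [hn']
  have hvar : variance (empiricalCov W n i k) P ≤ (∫ ω, Z 0 ω ^ 4 ∂μ) / n := by
    have hsum : variance (∑ a ∈ Finset.range n, fun ω => W a i ω * W a k ω) P ≤
        n * ∫ ω, Z 0 ω ^ 4 ∂μ := by
      rw [IndepFun.variance_sum (fun a _ => hL a)]
      · refine (Finset.sum_le_card_nsmul _ _ _
          fun a _ => variance_mul_copies_le hZ hZc hW a i k).trans_eq ?_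
        simp
      · intro a _ a' _ haa'
        exact (hW.indep.indepFun haa').comp
          ((measurable_pi_apply i).mul (measurable_pi_apply k))
          ((measurable_pi_apply i).mul (measurable_pi_apply k))
    have hdef : empiricalCov W n i k =
        fun ω => (n : ℝ)⁻¹ * (∑ a ∈ Finset.range n, fun ω => W a i ω * W a k ω) ω := by
      funext ω
      simp [empiricalCov]
    rw [hdef, variance_const_mul]
    refine (mul_le_mul_of_nonneg_left hsum (by positivity)).trans_eq ?_
    field_simp
  rw [variance_eq_integral (memLp_empiricalCov hZ hZc hW n i k).aestronglyMeasurable.aemeasurable,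
    hmean] at hvar
  exact hvar

end Stationary

/-! ### The banded empirical covariance is close to the Laurent operator -/

/-- The part of the `i`-th row of the Laurent matrix, indexed by the offset `m = i - l`, which
falls outside the band or outside the range of the columns. -/
def tailTerm (R : ℤ → ℝ) (b : ℝ) (p : ℕ) (i m : ℤ) : ℝ :=
  if b < |(m : ℝ)| ∨ i - m ∉ Set.range (fun k : Fin p => (k : ℤ)) then R m ^ 2 else 0

theorem tailTerm_nonneg (R : ℤ → ℝ) (b : ℝ) (p : ℕ) (i m : ℤ) : 0 ≤ tailTerm R b p i m := by
  unfold tailTerm; split_ifs <;> positivity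

theorem tailTerm_le (R : ℤ → ℝ) (b : ℝ) (p : ℕ) (i m : ℤ) : tailTerm R b p i m ≤ R m ^ 2 := by
  unfold tailTerm; split_ifs <;> [exact le_rfl; positivity]

theorem summable_sq {R : ℤ → ℝ} (hR : Summable fun j => |R j|) : Summable fun j => R j ^ 2 := by
  refine (hR.mul_left (∑' j, |R j|)).of_nonneg_of_le (fun j => sq_nonneg _) fun j => ?_
  rw [← sq_abs, pow_two]
  exact mul_le_mul_of_nonneg_right (hR.le_tsum j fun _ _ => abs_nonneg _) (abs_nonneg _)

theorem summable_tailTerm {R : ℤ → ℝ} (hR : Summable fun j => |R j|) (b : ℝ) (p : ℕ) (i : ℤ) :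
    Summable (tailTerm R b p i) :=
  (summable_sq hR).of_nonneg_of_le (tailTerm_nonneg R b p i) (tailTerm_le R b p i)

/-- The squared distance of a banded matrix to the Laurent matrix splits into the error inside the
band and the deterministic tail. -/
theorem laurentDefect_band {p : ℕ} (A : Matrix (Fin p) (Fin p) ℝ) {R : ℤ → ℝ}
    (hR : Summable fun j => |R j|) (b : ℝ) :
    laurentDefect (Matrix.of fun i j => bandMatrix b p i j * A i j) R =
      (∑ i : Fin p, ∑ k : Fin p,
        if |(i : ℝ) - (k : ℝ)| ≤ b then (A i k - R ((i : ℤ) - k)) ^ 2 else 0) +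
      ∑ i : Fin p, ∑' m, tailTerm R b p i m := by
  rw [laurentDefect, ← Finset.sum_add_distrib]
  refine Finset.sum_congr rfl fun i _ => ?_
  set B : Fin p → ℝ := fun k =>
    if |(i : ℝ) - (k : ℝ)| ≤ b then (A i k - R ((i : ℤ) - k)) ^ 2 else 0 with hB
  have h1 : HasSum (zeroExtend B) (∑ k, B k) := hasSum_zeroExtend B
  have h2 : HasSum (fun l => tailTerm R b p i ((i : ℤ) - l)) (∑' m, tailTerm R b p i m) :=
    ((Equiv.subLeft (i : ℤ)).hasSum_iff (f := tailTerm R b p i)).2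
      (summable_tailTerm hR b p i).hasSum
  refine HasSum.tsum_eq ((h1.add h2).congr_fun fun l => ?_)
  by_cases hl : l ∈ Set.range fun k : Fin p => (k : ℤ)
  · obtain ⟨k, rfl⟩ := hl
    have hr : (k : ℤ) ∈ Set.range fun k : Fin p => (k : ℤ) := ⟨k, rfl⟩
    simp only [rowDefect, tailTerm, zeroExtend_coe, hB, sub_sub_cancel, hr, not_true_eq_false,
      or_false, Matrix.of_apply, bandMatrix]
    push_cast
    by_cases hb : |(i : ℝ) - (k : ℝ)| ≤ b
    · simp [hb, not_lt.2 hb]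
    · simp [hb, not_le.1 hb]
  · simp only [rowDefect, tailTerm, zeroExtend_of_notMem_range _ hl, sub_sub_cancel]
    rw [if_pos (Or.inr hl)]
    ring

theorem card_band_le (b : ℝ) (hb : 0 ≤ b) (p : ℕ) (i : Fin p) :
    ((Finset.univ.filter fun k : Fin p => |(i : ℝ) - (k : ℝ)| ≤ b).card : ℝ) ≤ 2 * b + 1 := by
  have h : (Finset.univ.filter fun k : Fin p => |(i : ℝ) - (k : ℝ)| ≤ b).card ≤
      (Finset.Icc (-⌊b⌋) ⌊b⌋).card := by
    refine Finset.card_le_card_of_injOn (fun k => (k : ℤ) - i) (fun k hk => ?_)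
      fun k _ l _ hkl => injective_coe_int p (by simpa using hkl)
    have hk' : |(i : ℝ) - (k : ℝ)| ≤ b := by simpa using hk
    rw [abs_le] at hk'
    have h1 : (k : ℤ) - i ≤ ⌊b⌋ := Int.le_floor.2 (by push_cast; linarith)
    have h2 : (i : ℤ) - k ≤ ⌊b⌋ := Int.le_floor.2 (by push_cast; linarith)
    simp only [Finset.coe_Icc, Set.mem_Icc]
    omega
  have h0 : 0 ≤ ⌊b⌋ := Int.floor_nonneg.2 hb
  have hc : (((Finset.Icc (-⌊b⌋) ⌊b⌋).card : ℤ) : ℝ) = 2 * ⌊b⌋ + 1 := by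
    rw [Int.card_Icc, Int.toNat_of_nonneg (by omega)]
    push_cast; ring
  calc _ ≤ ((Finset.Icc (-⌊b⌋) ⌊b⌋).card : ℝ) := by exact_mod_cast h
    _ = 2 * ⌊b⌋ + 1 := by exact_mod_cast hc
    _ ≤ 2 * b + 1 := by linarith [Int.floor_le b]

/-- Only the first or last `|m|` rows have their offset-`m` entry outside the matrix. -/
theorem card_out_of_range_le (p : ℕ) (m : ℤ) :
    (Finset.univ.filter fun i : Fin p =>
      (i : ℤ) - m ∉ Set.range fun k : Fin p => (k : ℤ)).card ≤ m.natAbs := by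
  have hmem : ∀ i : Fin p, (i : ℤ) - m ∉ Set.range (fun k : Fin p => (k : ℤ)) →
      (i : ℤ) < m ∨ (p : ℤ) + m ≤ i := by
    intro i hi
    by_contra! h
    exact hi ⟨⟨((i : ℤ) - m).toNat, by omega⟩, by simp; omega⟩
  rw [← Finset.card_range m.natAbs]
  refine Finset.card_le_card_of_injOn (fun i => if 0 ≤ m then (i : ℕ) else p - 1 - i)
    (fun i hi => ?_) fun i _ j _ hij => ?_
  · have := hmem i (by simpa using hi)
    simp only [Finset.coe_range, Set.mem_Iio]
    split_ifs <;> omega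
  · ext
    simp only at hij
    split_ifs at hij <;> omega

/-- The deterministic part of the defect is negligible compared to the size of the matrix. -/
theorem tendsto_tail {R : ℤ → ℝ} (hR : Summable fun j => |R j|) {b : ℕ → ℝ}
    (hb : Tendsto b atTop atTop) :
    Tendsto (fun p : ℕ => (p : ℝ)⁻¹ * ∑ i : Fin p, ∑' m, tailTerm R (b p) p i m) atTop (𝓝 0) := by
  have hswap : ∀ p : ℕ, (p : ℝ)⁻¹ * ∑ i : Fin p, ∑' m, tailTerm R (b p) p i m =
      ∑' m, (p : ℝ)⁻¹ * ∑ i : Fin p, tailTerm R (b p) p i m := by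
    intro p
    rw [tsum_mul_left, Summable.tsum_finsetSum fun (i : Fin p) _ =>
      summable_tailTerm hR (b p) p (i : ℤ)]
  simp only [hswap]
  rw [← tsum_zero (α := ℝ) (β := ℤ)]
  refine tendsto_tsum_of_dominated_convergence (summable_sq hR) (fun m => ?_)
    (Eventually.of_forall fun p m => ?_)
  -- once `b p ≥ |m|`, only the at most `|m|` rows near the boundary contribute at offset `m`
  · have hlim : Tendsto (fun p : ℕ => (p : ℝ)⁻¹ * (m.natAbs * R m ^ 2)) atTop (𝓝 0) := by
      simpa using tendsto_inv_atTop_nhds_zero_nat.mul_const (m.natAbs * R m ^ 2)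
    refine squeeze_zero' (Eventually.of_forall fun p => ?_) ?_ hlim
    · exact mul_nonneg (by positivity) (Finset.sum_nonneg fun i _ => tailTerm_nonneg _ _ _ _ _)
    · filter_upwards [hb.eventually_ge_atTop |(m : ℝ)|] with p hp
      refine mul_le_mul_of_nonneg_left ?_ (by positivity)
      simp only [tailTerm, not_lt.2 hp, false_or]
      rw [← Finset.sum_filter, Finset.sum_const, nsmul_eq_mul]
      exact mul_le_mul_of_nonneg_right (by exact_mod_cast card_out_of_range_le p m)
        (sq_nonneg _)
  · rw [Real.norm_of_nonneg
      (mul_nonneg (by positivity) (Finset.sum_nonneg fun i _ => tailTerm_nonneg _ _ _ _ _))]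
    rcases Nat.eq_zero_or_pos p with rfl | hp
    · simp; positivity
    rw [inv_mul_le_iff₀ (by positivity)]
    refine (Finset.sum_le_card_nsmul Finset.univ _ _
      fun (i : Fin p) _ => tailTerm_le R (b p) p (i : ℤ) m).trans_eq ?_
    simp

theorem laurentDefect_bandedCov {Ω : Type*} (W : ℕ → ℤ → Ω → ℝ) {R : ℤ → ℝ}
    (hR : Summable fun j => |R j|) (n p : ℕ) (b : ℝ) (ω : Ω) :
    laurentDefect (bandedCov W n p b ω) R =
      (∑ i : Fin p, ∑ k : Fin p, if |(i : ℝ) - (k : ℝ)| ≤ b then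
        (empiricalCov W n ((i : ℤ) + 1) ((k : ℤ) + 1) ω - R ((i : ℤ) - k)) ^ 2 else 0) +
      ∑ i : Fin p, ∑' m, tailTerm R b p i m := by
  refine (laurentDefect_band ((dataMatrix W n p ω).transpose * dataMatrix W n p ω) hR b).trans ?_
  congr 1
  refine Finset.sum_congr rfl fun i _ => Finset.sum_congr rfl fun k _ => ?_
  rw [transpose_mul_dataMatrix_apply]

section Expectation

variable {Ω₀ Ω : Type*} [MeasurableSpace Ω₀] [MeasurableSpace Ω] {μ : Measure Ω₀}
  [IsProbabilityMeasure μ] {P : Measure Ω} [IsProbabilityMeasure P] {Z : ℤ → Ω₀ → ℝ}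
  {W : ℕ → ℤ → Ω → ℝ}

theorem integrable_band_term (hZ : IsStationary μ Z) (hZc : HasSummableCumulants μ Z)
    (hW : IsIIDCopies μ Z P W) (n p : ℕ) (b : ℝ) (i k : Fin p) :
    Integrable (fun ω => if |(i : ℝ) - (k : ℝ)| ≤ b then
      (empiricalCov W n ((i : ℤ) + 1) ((k : ℤ) + 1) ω - covSeq μ Z ((i : ℤ) - k)) ^ 2 else 0)
      P := by
  split_ifs
  · exact ((memLp_empiricalCov hZ hZc hW n _ _).sub (memLp_const _)).integrable_sq
  · exact integrable_zero _ _ _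

theorem integrable_laurentDefect (hZ : IsStationary μ Z) (hZc : HasSummableCumulants μ Z)
    (hW : IsIIDCopies μ Z P W) (n p : ℕ) (b : ℝ) :
    Integrable (fun ω => laurentDefect (bandedCov W n p b ω) (covSeq μ Z)) P := by
  simp only [laurentDefect_bandedCov W (summable_covSeq hZ hZc)]
  exact (integrable_finsetSum _ fun i _ => integrable_finsetSum _ fun k _ =>
    integrable_band_term hZ hZc hW n p b i k).add (integrable_const _)

/-- The expected defect is the number of entries in the band times the mean squared error of each,
plus the deterministic tail. -/
theorem integral_laurentDefect_le (hZ : IsStationary μ Z) (hZc : HasSummableCumulants μ Z)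
    (hW : IsIIDCopies μ Z P W) {n : ℕ} (hn : 0 < n) (p : ℕ) {b : ℝ} (hb : 0 ≤ b) :
    ∫ ω, laurentDefect (bandedCov W n p b ω) (covSeq μ Z) ∂P ≤
      p * ((2 * b + 1) * ((∫ ω, Z 0 ω ^ 4 ∂μ) / n)) +
        ∑ i : Fin p, ∑' m, tailTerm (covSeq μ Z) b p i m := by
  have hK : 0 ≤ (∫ ω, Z 0 ω ^ 4 ∂μ) / n :=
    div_nonneg (integral_nonneg fun ω => by positivity) (by positivity)
  have hint := integrable_band_term hZ hZc hW n p b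
  simp only [laurentDefect_bandedCov W (summable_covSeq hZ hZc)]
  rw [integral_add (integrable_finsetSum _ fun i _ => integrable_finsetSum _ fun k _ => hint i k)
    (integrable_const _), integral_const, probReal_univ, one_smul,
    integral_finsetSum _ fun i _ => integrable_finsetSum _ fun k _ => hint i k]
  simp only [fun i : Fin p => integral_finsetSum Finset.univ fun k _ => hint i k]
  refine add_le_add_left ?_ _
  refine (Finset.sum_le_card_nsmul _ _ ((2 * b + 1) * ((∫ ω, Z 0 ω ^ 4 ∂μ) / n))
    fun i _ => ?_).trans_eq (by simp)
  calc _ ≤ ∑ k : Fin p, if |(i : ℝ) - (k : ℝ)| ≤ b then (∫ ω, Z 0 ω ^ 4 ∂μ) / n else 0 := by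
        refine Finset.sum_le_sum fun k _ => ?_
        split_ifs
        · have := integral_empiricalCov_sub_sq_le hZ hZc hW hn ((i : ℤ) + 1) ((k : ℤ) + 1)
          rwa [add_sub_add_right_eq_sub] at this
        · simp
    _ ≤ (2 * b + 1) * ((∫ ω, Z 0 ω ^ 4 ∂μ) / n) := by
        rw [← Finset.sum_filter, Finset.sum_const, nsmul_eq_mul]
        exact mul_le_mul_of_nonneg_right (card_band_le b hb p i) hK

/-- The expected defect per row is `O(b / n)` inside the band, up to the deterministic tail, so it
tends to zero. -/
theorem tendsto_integral_laurentDefect (hZ : IsStationary μ Z) (hZc : HasSummableCumulants μ Z)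
    (hW : IsIIDCopies μ Z P W) {n : ℕ → ℕ} {b : ℕ → ℝ}
    (hn_pos : ∀ p, 1 ≤ p → 0 < n p) (hb_pos : ∀ p, 1 ≤ p → 0 < b p)
    (hb : Tendsto b atTop atTop) (hn : Tendsto n atTop atTop)
    (hbn : Tendsto (fun p => b p / (n p : ℝ)) atTop (𝓝 0)) :
    Tendsto (fun p : ℕ => (p : ℝ)⁻¹ *
      ∫ ω, laurentDefect (bandedCov W (n p) p (b p) ω) (covSeq μ Z) ∂P) atTop (𝓝 0) := by
  set K := ∫ ω, Z 0 ω ^ 4 ∂μ with hK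
  have hinv : Tendsto (fun p => ((n p : ℝ))⁻¹) atTop (𝓝 0) :=
    tendsto_inv_atTop_nhds_zero_nat.comp hn
  have hband : Tendsto (fun p => (2 * b p + 1) * (K / n p)) atTop (𝓝 0) := by
    have h := ((hbn.const_mul 2).add hinv).const_mul K
    simp only [mul_zero, add_zero] at h
    refine h.congr fun p => ?_
    ring
  have hlim := hband.add (tendsto_tail (summable_covSeq hZ hZc) hb)
  rw [add_zero] at hlim
  refine squeeze_zero' (Eventually.of_forall fun p => ?_) ?_ hlim
  · refine mul_nonneg (by positivity) (integral_nonneg fun ω => ?_)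
    exact Finset.sum_nonneg fun i _ => tsum_nonneg fun l => sq_nonneg _
  · filter_upwards [eventually_ge_atTop 1] with p hp
    have hp' : (0 : ℝ) < p := by exact_mod_cast hp
    have h := integral_laurentDefect_le hZ hZc hW (hn_pos p hp) p (hb_pos p hp).le
    refine (mul_le_mul_of_nonneg_left h (by positivity)).trans_eq ?_
    rw [mul_add, inv_mul_cancel_left₀ hp'.ne']

end Expectation

/-! ### Weak convergence in probability -/

/-- Every function is integrable against a finite sum of point masses, so `f` is arbitrary. For
`p = 0` both sides are zero: the sum over `Fin 0` is empty. -/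
theorem integral_empiricalMeasure {Ω : Type*} (W : ℕ → ℤ → Ω → ℝ) (n p : ℕ) (b : ℝ) (ω : Ω)
    (f : ℝ → ℝ) :
    ∫ x, f x ∂(empiricalMeasure W n p b ω) =
      (p : ℝ)⁻¹ * ∑ j, f ((bandedCov_isHermitian W n p b ω).eigenvalues j) := by
  rw [empiricalMeasure, integral_smul_measure,
    integral_finsetSum_measure fun j _ => integrable_dirac (by simp)]
  simp

theorem tendstoWeaklyInProbability_empiricalMeasure {Ω₀ Ω : Type*} [MeasurableSpace Ω₀]
    [MeasurableSpace Ω] {μ : Measure Ω₀} [IsProbabilityMeasure μ] {P : Measure Ω}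
    [IsProbabilityMeasure P] {Z : ℤ → Ω₀ → ℝ} {W : ℕ → ℤ → Ω → ℝ}
    (hZ : IsStationary μ Z) (hZc : HasSummableCumulants μ Z)
    (hW : IsIIDCopies μ Z P W) {n : ℕ → ℕ} {b : ℕ → ℝ}
    (hn_pos : ∀ p, 1 ≤ p → 0 < n p) (hb_pos : ∀ p, 1 ≤ p → 0 < b p)
    (hb : Tendsto b atTop atTop) (hn : Tendsto n atTop atTop)
    (hbn : Tendsto (fun p => b p / (n p : ℝ)) atTop (𝓝 0)) :
    TendstoWeaklyInProbability P (fun p ω => empiricalMeasure W (n p) p (b p) ω)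
      (spectralLaw (covSeq μ Z)) := by
  intro f
  have hR := summable_covSeq hZ hZc
  rw [tendstoInMeasure_iff_measureReal_dist]
  intro δ hδ
  obtain ⟨C, hC0, hC⟩ := exists_abs_sub_le_add_mul_sq f (∑' j, |covSeq μ Z j|) (half_pos hδ)
  set D : ℕ → Ω → ℝ := fun p ω =>
    C * ((p : ℝ)⁻¹ * laurentDefect (bandedCov W (n p) p (b p) ω) (covSeq μ Z)) with hD
  have hD0 : ∀ p ω, 0 ≤ D p ω := fun p ω => mul_nonneg hC0 (mul_nonneg (by positivity)
    (Finset.sum_nonneg fun i _ => tsum_nonneg fun l => sq_nonneg _))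
  have hDi : ∀ p, Integrable (D p) P := fun p =>
    ((integrable_laurentDefect hZ hZc hW (n p) p (b p)).const_mul _).const_mul _
  have hDlim : Tendsto (fun p => (∫ ω, D p ω ∂P) / (δ / 2)) atTop (𝓝 0) := by
    simp only [hD, integral_const_mul]
    simpa using ((tendsto_integral_laurentDefect hZ hZc hW hn_pos hb_pos hb hn hbn).const_mul
      C).div_const (δ / 2)
  refine squeeze_zero' (Eventually.of_forall fun p => measureReal_nonneg) ?_ hDlim
  filter_upwards [eventually_ge_atTop 1] with p hp
  have hp' : (0 : ℝ) < p := by exact_mod_cast hp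
  rw [le_div_iff₀ (half_pos hδ), mul_comm]
  refine le_trans (mul_le_mul_of_nonneg_left (measureReal_mono fun ω hω => ?_) (half_pos hδ).le)
    (mul_meas_ge_le_integral_of_nonneg (Eventually.of_forall (hD0 p)) (hDi p) (δ / 2))
  have hω' : δ ≤ |∫ x, f x ∂(empiricalMeasure W (n p) p (b p) ω) -
    ∫ x, f x ∂(spectralLaw (covSeq μ Z))| := hω
  have hmain := abs_sum_eigenvalues_sub_le (bandedCov_isHermitian W (n p) p (b p) ω) hR
    (covSeq_neg hZ hZc) f.continuous (fun x θ => hC x _ (abs_spectralDensity_le hR θ))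
  have hscale : |∫ x, f x ∂(empiricalMeasure W (n p) p (b p) ω) -
      ∫ x, f x ∂(spectralLaw (covSeq μ Z))| ≤ δ / 2 + D p ω := by
    rw [integral_empiricalMeasure]
    have h := mul_le_mul_of_nonneg_left hmain (inv_nonneg.2 hp'.le)
    rw [← abs_of_pos (inv_pos.2 hp'), ← abs_mul, abs_of_pos (inv_pos.2 hp'), mul_sub, mul_add,
      inv_mul_cancel_left₀ hp'.ne', inv_mul_cancel_left₀ hp'.ne', mul_left_comm] at h
    exact h
  -- `δ ≤ δ / 2 + D p ω`, so `ω` lies in the event to which Markov's inequality was applied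
  simp only [Set.mem_ofPred_eq]
  linarith

end BandedCovariance

end

theorem theorem2p3
    {Ω₀ Ω : Type*} [MeasurableSpace Ω₀] [MeasurableSpace Ω]
    (μ : Measure Ω₀) [IsProbabilityMeasure μ] (P : Measure Ω) [IsProbabilityMeasure P]
    (n : ℕ → ℕ) (b : ℕ → ℝ)
    (hn_pos : ∀ p, 1 ≤ p → 0 < n p) (hb_pos : ∀ p, 1 ≤ p → 0 < b p)
    (hb_le : ∀ p : ℕ, 1 ≤ p → b p ≤ p)
    (hb : Tendsto b atTop atTop) (hn : Tendsto n atTop atTop)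
    (hbn : Tendsto (fun p => b p / (n p : ℝ)) atTop (𝓝 0))
    (Z : ℤ → Ω₀ → ℝ) (hZ : BandedCovariance.IsStationary μ Z)
    (hZc : BandedCovariance.HasSummableCumulants μ Z)
    (W : ℕ → ℤ → Ω → ℝ) (hW : BandedCovariance.IsIIDCopies μ Z P W) :
    (∀ θ : ℝ, HasSum
      (fun j : ℤ => Complex.exp (2 * Real.pi * Complex.I * j * θ) *
        (BandedCovariance.covSeq μ Z j : ℂ))
      (BandedCovariance.spectralDensity (BandedCovariance.covSeq μ Z) θ : ℂ)) ∧
    (∀ k : ℕ,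
      Integrable (fun x : ℝ => x ^ k)
        (BandedCovariance.spectralLaw (BandedCovariance.covSeq μ Z)) ∧
      ∫ x, x ^ k ∂(BandedCovariance.spectralLaw (BandedCovariance.covSeq μ Z)) =
        BandedCovariance.convPow (BandedCovariance.covSeq μ Z) k 0) ∧
    BandedCovariance.TendstoWeaklyInProbability P
      (fun p ω => BandedCovariance.empiricalMeasure W (n p) p (b p) ω)
      (BandedCovariance.spectralLaw (BandedCovariance.covSeq μ Z)) := by
  have hR := BandedCovariance.summable_covSeq hZ hZc
  have heven := BandedCovariance.covSeq_neg hZ hZc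
  refine ⟨fun θ => ?_, fun k => ⟨BandedCovariance.integrable_spectralLaw hR (continuous_pow k),
    BandedCovariance.integral_pow_spectralLaw hR heven k⟩,
    BandedCovariance.tendstoWeaklyInProbability_empiricalMeasure hZ hZc hW hn_pos hb_pos hb hn hbn⟩
  rw [← BandedCovariance.trigSeries_eq_spectralDensity hR heven]
  exact BandedCovariance.hasSum_trigSeries (by simpa using hR) θ
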